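/- Let $K$ be a field of characteristic zero and let $\mathcal A$ be a line arrangement in $\mathbf P^2_K$, i.e. a finite set of lines. An intersection point of $\mathcal A$ is a point of $\mathbf P^2_K$ which is the intersection of the lines of some subset of $\mathcal A$; for such a point $q$ let $\mathcal A_q$ be the set of lines of $\mathcal A$ through $q$. Let $n_2(\mathcal A)$ be the number of intersection points $q$ with $|\mathcal A_q|=2$. Assume that $\mathcal A$ is supersolvable with modular point $p$: that is, $p$ is an intersection point of $\mathcal A$ such that for all distinct $H,L\in\mathcal A\setminus\mathcal A_p$ there is a unique $M\in\mathcal A_p$ with $H\cap L\subset M$. Put $m=|\mathcal A_p|$ and assume $|\mathcal A\setminus\mathcal A_p|\ge 1$. Then $$n_2(\mathcal A)\ \ge\ \max\{|\mathcal A|-m,\ m\}.$$ -/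

import Mathlib

/-- A line arrangement in the projective plane over `K`: a finite set of lines, each given as a
linear plane (a two-dimensional subspace) of the three-dimensional space `K³`. -/
structure LineArrangement (K : Type*) [Field K] where
  /-- The lines of the arrangement. -/
  lines : Finset (Submodule K (Fin 3 → K))
  finrank_eq_two : ∀ H ∈ lines, Module.finrank K H = 2

namespace LineArrangement

variable {K : Type*} [Field K]

/-- The intersection lattice: all intersections of subsets of the arrangement. The empty
intersection is the whole space `K³`. -/
def latticeL (A : LineArrangement K) : Set (Submodule K (Fin 3 → K)) :=
  {X | ∃ B : Set (Submodule K (Fin 3 → K)), B ⊆ A.lines ∧ X = sInf B}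

/-- The intersection points of the arrangement: the members of the intersection lattice of
codimension two in `K³`, that is, of dimension one (points of the projective plane). -/
def points (A : LineArrangement K) : Set (Submodule K (Fin 3 → K)) :=
  {X | X ∈ A.latticeL ∧ Module.finrank K X = 1}

open Classical in
/-- The lines of the arrangement that pass through `p`. -/
noncomputable def linesThrough (A : LineArrangement K) (p : Submodule K (Fin 3 → K)) :
    Finset (Submodule K (Fin 3 → K)) :=
  A.lines.filter (fun H => p ≤ H)

/-- The Möbius function at a point: the number of lines through it, minus one. -/
noncomputable def mu (A : LineArrangement K) (p : Submodule K (Fin 3 → K)) : ℤ :=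
  ((A.linesThrough p).card : ℤ) - 1

/-- The number of double points (a finite set, as the intersection lattice is finite). -/
noncomputable def n2 (A : LineArrangement K) : ℕ :=
  {q | q ∈ A.points ∧ A.mu q = 1}.ncard

/-- `p` is a modular point: an intersection point such that any two distinct lines not passing
through `p` meet on a unique line of the arrangement passing through `p`. The arrangement is
supersolvable when it has a modular point. -/
def IsModularPoint (A : LineArrangement K) (p : Submodule K (Fin 3 → K)) : Prop :=
  p ∈ A.points ∧
    ∀ H ∈ A.lines, ∀ L ∈ A.lines, ¬ p ≤ H → ¬ p ≤ L → H ≠ L →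
      ∃! M, M ∈ A.linesThrough p ∧ H ⊓ L ≤ M

end LineArrangement

/-! Send `p` to infinity: the lines through it become the verticals `x = d`, `d ∈ D`, with `m =
|D|`, and every other line is, up to sign, the graph of some `l = b x + a`. Modularity says that two
such graphs always cross over a point of `D`. The key claim (`exists_isolated_direction`) is that
each graph meets some vertical at a point on no other graph, hence at a double point.

Let `Q = ∏ (x - d)`. Newton interpolation (`exists_interpolation`) gives `G(x, y)` of total degree
below `m` with `G(x, l) = b Q - l Q' / m` for every graph; equivalently, `Q ∂_x + (Q' y / m + G)
∂_y` is tangent to all the lines. If every vertical meets the graph of `l` on another graph,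
comparing the two values of `G` gives `∂_y G(x, l) = (1 - 1/m) Q'` at each `d ∈ D`. Both sides have
degree below `m`, so they are equal; but the left side has degree below `m - 1`, and the coefficient
of `x ^ (m - 1)` on the right is `m - 1 ≠ 0`.

Thus there are at least as many double points as graphs. The bound by `m` is then a count: each of
`k` graphs crosses the others over at most `k - 1` verticals. -/

/-! ### Total degree of polynomials in two variables. -/

open Polynomial in
/-- `f` has total degree less than `n` as a polynomial in two variables. -/
def BivariateDegreeLT {K : Type*} [Field K] (n : ℕ) (f : K[X][X]) : Prop :=
  ∀ i, f.coeff i ∈ degreeLT K (n - i)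

namespace BivariateDegreeLT

open Polynomial

variable {K : Type*} [Field K] {n : ℕ} {f g : K[X][X]}

theorem add (hf : BivariateDegreeLT n f) (hg : BivariateDegreeLT n g) :
    BivariateDegreeLT n (f + g) := fun i => by
  rw [coeff_add]
  exact add_mem (hf i) (hg i)

theorem coeff_eq_zero (hf : BivariateDegreeLT n f) {i : ℕ} (hi : n ≤ i) : f.coeff i = 0 := by
  have := hf i
  rw [Nat.sub_eq_zero_of_le hi, mem_degreeLT, degree_lt_iff_coeff_zero] at this
  ext j
  simpa using this j (Nat.zero_le _)

theorem linear_mul_mem_degreeLT {k : ℕ} {q : K[X]} (hq : q ∈ degreeLT K k) (b a : K) :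
    (C b * X + C a) * q ∈ degreeLT K (k + 1) := by
  rw [mem_degreeLT] at *
  rcases eq_or_ne q 0 with rfl | h0
  · simp
  · rw [degree_mul]
    have h1 : (C b * X + C a).degree ≤ 1 := degree_linear_le
    rw [degree_eq_natDegree h0] at *
    have h2 : q.natDegree < k := by exact_mod_cast hq
    calc _ ≤ (1 : WithBot ℕ) + (q.natDegree : WithBot ℕ) := by gcongr
      _ < _ := by
        norm_cast
        omega

theorem X_sub_C_mul (hf : BivariateDegreeLT n f) (b a : K) :
    BivariateDegreeLT (n + 1) ((X - C (C b * X + C a)) * f) := fun i => by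
  have key : (C b * X + C a) * f.coeff i ∈ degreeLT K (n + 1 - i) := by
    rcases le_or_gt i n with h | h
    · rw [show n + 1 - i = n - i + 1 by omega]
      exact linear_mul_mem_degreeLT (hf i) b a
    · simp [hf.coeff_eq_zero h.le]
  rw [sub_mul, coeff_sub, coeff_C_mul]
  refine sub_mem ?_ key
  cases i with
  | zero => simp
  | succ i =>
    rw [coeff_X_mul, Nat.add_sub_add_right]
    exact hf i

theorem linear_pow_mul_mem_degreeLT {k : ℕ} {q : K[X]} (hq : q ∈ degreeLT K k) (b a : K) (r : ℕ) :
    (C b * X + C a) ^ r * q ∈ degreeLT K (k + r) := by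
  induction r with
  | zero => simpa
  | succ r ih =>
    rw [pow_succ', mul_assoc, ← add_assoc]
    exact linear_mul_mem_degreeLT ih b a

theorem eval_mem (hf : BivariateDegreeLT n f) (b a : K) :
    f.eval (C b * X + C a) ∈ degreeLT K n := by
  rw [eval_eq_sum, Polynomial.sum]
  refine sum_mem fun i hi => ?_
  have hin : i < n := by
    by_contra h
    exact (mem_support_iff.1 hi) (hf.coeff_eq_zero (not_lt.1 h))
  have := linear_pow_mul_mem_degreeLT (hf i) b a i
  rwa [Nat.sub_add_cancel hin.le, mul_comm] at this

theorem derivative (hf : BivariateDegreeLT n f) :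
    BivariateDegreeLT (n - 1) (derivative f) := fun i => by
  rw [coeff_derivative, show n - 1 - i = n - (i + 1) by omega, mul_comm,
    show ((i : K[X]) + 1) = C ((i : K) + 1) by simp, ← smul_eq_C_mul]
  exact Submodule.smul_mem _ _ (hf _)

theorem C_mul_prod {ι : Type*} (S : Finset ι) (a b : ι → K) {h : K[X]} {k : ℕ}
    (hh : h ∈ degreeLT K k) :
    BivariateDegreeLT (k + S.card) (C h * ∏ j ∈ S, (X - C (C (b j) * X + C (a j)))) := by
  classical
  induction S using Finset.induction_on with
  | empty =>
    intro i
    cases i with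
    | zero => simpa using hh
    | succ i => simp
  | insert j S hj ih =>
    rw [Finset.prod_insert hj, Finset.card_insert_of_notMem hj, mul_left_comm, ← add_assoc]
    exact ih.X_sub_C_mul _ _

end BivariateDegreeLT

/-! ### Interpolation and isolated directions. -/

section AffinePoints

open Polynomial

variable {K ι : Type*} [Field K]

theorem prod_X_sub_C_dvd_of_eval_eq_zero {R : Type*} [CommRing R] [IsDomain R] (S : Finset ι)
    (f : ι → R) (hf : Set.InjOn f S) (g : R[X]) (h : ∀ j ∈ S, g.eval (f j) = 0) :
    ∏ j ∈ S, (X - C (f j)) ∣ g := by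
  classical
  rcases eq_or_ne g 0 with rfl | h0
  · exact dvd_zero _
  have : ∏ j ∈ S, (X - C (f j)) = ((S.val.map f).map fun r => X - C r).prod := by
    rw [Multiset.map_map]
    rfl
  rw [this, Multiset.prod_X_sub_C_dvd_iff_le_roots h0,
    Multiset.le_iff_subset (Multiset.Nodup.map_on (fun x hx y hy => hf hx hy) S.nodup)]
  intro r hr
  obtain ⟨j, hj, rfl⟩ := Multiset.mem_map.1 hr
  exact (mem_roots h0).2 (h j hj)

/-- Values prescribed at the linear polynomials `b i * X + a i` (the restrictions of a logarithmic
derivation of the pencil of lines `D`). -/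
noncomputable def pencilValue (D : Finset K) (b a : K) : K[X] :=
  C b * ∏ d ∈ D, (X - C d) -
    (C b * X + C a) * (C (D.card : K)⁻¹ * derivative (∏ d ∈ D, (X - C d) : K[X]))

/-- The slope of `pencilValue` along the lines of direction `d`. -/
noncomputable def pencilSlope [DecidableEq K] (D : Finset K) (d : K) : K[X] :=
  ∏ e ∈ D.erase d, (X - C e) - C (D.card : K)⁻¹ * derivative (∏ d ∈ D, (X - C d) : K[X])

theorem linear_sub_linear {a b a' b' d : K} (h : b * d + a = b' * d + a') :
    (C b * X + C a) - (C b' * X + C a') = C (b - b') * (X - C d) := by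
  have : a - a' = -((b - b') * d) := by linear_combination h
  rw [show (C b * X + C a) - (C b' * X + C a') = C (b - b') * X + C (a - a') by
    simp only [C_sub]; ring, this]
  simp only [C_neg, C_mul]
  ring

/-- Since `l - l' = (b - b') (X - d)`, the term `(b - b') Q` is `l - l'` times `Q / (X - d)`. The
quotient depends on `d` only, which is what makes interpolation possible. -/
theorem pencilValue_sub [DecidableEq K] {D : Finset K} {a b a' b' d : K} (hd : d ∈ D)
    (h : b * d + a = b' * d + a') :
    pencilValue D b a - pencilValue D b' a' =
      ((C b * X + C a) - (C b' * X + C a')) * pencilSlope D d := by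
  have h1 := linear_sub_linear h
  have h2 := Finset.mul_prod_erase D (fun d => X - C d) hd
  rw [pencilValue, pencilValue, pencilSlope, mul_sub, h1, mul_assoc, h2,
    mul_assoc, ← mul_assoc (C (b - b')), ← h1]
  simp only [C_sub]
  ring

theorem degree_prod_X_sub_C (D : Finset K) :
    (∏ d ∈ D, (X - C d)).degree = (D.card : WithBot ℕ) := by
  simp [degree_prod]

theorem coeff_derivative_prod (D : Finset K) (hD : D.Nonempty) :
    (derivative (∏ d ∈ D, (X - C d) : K[X])).coeff (D.card - 1) = D.card := by
  have h := hD.card_pos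
  rw [coeff_derivative, Nat.sub_add_cancel h]
  have h1 : (∏ d ∈ D, (X - C d)).Monic := monic_prod_of_monic _ _ fun d _ => monic_X_sub_C d
  have h2 : (∏ d ∈ D, (X - C d)).natDegree = D.card := by simp
  have h3 := h1.coeff_natDegree
  rw [h2] at h3
  rw [h3, one_mul, Nat.cast_sub h]
  simp

theorem derivative_prod_mem_degreeLT (D : Finset K) :
    derivative (∏ d ∈ D, (X - C d) : K[X]) ∈ degreeLT K D.card := by
  rw [mem_degreeLT, ← degree_prod_X_sub_C]
  exact degree_derivative_lt (monic_prod_of_monic _ _ fun d _ => monic_X_sub_C d).ne_zero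

/-- The factor `1 / m` is chosen so that the terms of degree `m` cancel: `b - b * m / m = 0`. -/
theorem pencilValue_mem_degreeLT [CharZero K] (D : Finset K) (hD : D.Nonempty) (b a : K) :
    pencilValue D b a ∈ degreeLT K D.card := by
  have hm : (D.card : K) ≠ 0 := by exact_mod_cast hD.card_pos.ne'
  have h1 : (∏ d ∈ D, (X - C d)) ∈ degreeLT K (D.card + 1) := by
    rw [mem_degreeLT, degree_prod_X_sub_C]
    exact_mod_cast Nat.lt_succ_self _
  have h2 : pencilValue D b a ∈ degreeLT K (D.card + 1) := by
    refine sub_mem ?_ (BivariateDegreeLT.linear_mul_mem_degreeLT ?_ b a)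
    · rw [← smul_eq_C_mul]
      exact Submodule.smul_mem _ _ h1
    · rw [← smul_eq_C_mul]
      exact Submodule.smul_mem _ _ (derivative_prod_mem_degreeLT D)
  rw [mem_degreeLT, degree_lt_iff_coeff_zero] at h2 ⊢
  intro i hi
  rcases hi.eq_or_lt with rfl | hi
  · have h3 : (∏ d ∈ D, (X - C d)).coeff D.card = 1 := by
      have h1 : (∏ d ∈ D, (X - C d)).Monic :=
        monic_prod_of_monic _ _ fun d _ => monic_X_sub_C d
      have h2 : (∏ d ∈ D, (X - C d)).natDegree = D.card := by simp
      simpa [h2] using h1.coeff_natDegree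
    have h4 : (derivative (∏ d ∈ D, (X - C d) : K[X])).coeff D.card = 0 := by
      have := derivative_prod_mem_degreeLT D
      rw [mem_degreeLT, degree_lt_iff_coeff_zero] at this
      exact this _ le_rfl
    have h5 := coeff_derivative_prod D hD
    obtain ⟨k, hk⟩ : ∃ k, D.card = k + 1 := ⟨D.card - 1, (Nat.sub_add_cancel hD.card_pos).symm⟩
    rw [hk, Nat.add_sub_cancel] at h5
    rw [pencilValue, add_mul, coeff_sub, coeff_add, coeff_C_mul, h3, coeff_C_mul, coeff_C_mul, h4,
      hk, mul_assoc, coeff_C_mul, coeff_X_mul, coeff_C_mul, h5, ← hk]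
    field_simp
    simp
  · exact h2 i hi

/-- The alternative `h = 0` covers `n < k`, where `n - k` truncates. -/
theorem exists_mem_degreeLT_of_mul_mem {q h : K[X]} {n k : ℕ} (hq : q.degree = k)
    (hqh : q * h ∈ degreeLT K n) : h ∈ degreeLT K (n - k) ∧ (k ≤ n ∨ h = 0) := by
  rcases eq_or_ne h 0 with rfl | h0
  · exact ⟨zero_mem _, Or.inr rfl⟩
  · rw [mem_degreeLT, degree_mul, hq, degree_eq_natDegree h0] at hqh
    have : k + h.natDegree < n := by exact_mod_cast hqh
    refine ⟨?_, Or.inl (by omega)⟩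
    rw [mem_degreeLT, degree_eq_natDegree h0]
    norm_cast
    omega

/-- Newton interpolation of `pencilValue` at linear polynomials, any two of which agree at a point
of `D`. -/
theorem exists_interpolation [CharZero K] (D : Finset K) (hD : D.Nonempty) (S : Finset ι)
    (a b : ι → K) (hb : Set.InjOn b S)
    (hS : ∀ i ∈ S, ∀ j ∈ S, i ≠ j → ∃ d ∈ D, b i * d + a i = b j * d + a j) :
    ∃ G : K[X][X], BivariateDegreeLT D.card G ∧
      ∀ i ∈ S, G.eval (C (b i) * X + C (a i)) = pencilValue D (b i) (a i) := by
  classical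
  induction S using Finset.induction_on with
  | empty => exact ⟨0, fun i => by simp, by simp⟩
  | insert s S hs ih =>
    obtain ⟨G, hG, hGS⟩ := ih (hb.mono (by simp))
      fun i hi j hj => hS i (Finset.mem_insert_of_mem hi) j (Finset.mem_insert_of_mem hj)
    have hbs : ∀ j ∈ S, b s - b j ≠ 0 := fun j hj h => hs <| by
      rwa [hb (Finset.mem_insert_self _ _) (Finset.mem_insert_of_mem hj) (sub_eq_zero.1 h)]
    choose! δ hδ using fun j (hj : j ∈ S) => hS s (Finset.mem_insert_self _ _) j
      (Finset.mem_insert_of_mem hj) (by rintro rfl; exact hs hj)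
    let l : ι → K[X] := fun j => C (b j) * X + C (a j)
    have hl : Set.InjOn l S := fun i hi j hj h => by
      have h1 := congrArg (fun q => coeff q 1) h
      simp only [l, coeff_add, coeff_C_mul_X, coeff_C] at h1
      exact hb (Finset.mem_insert_of_mem hi) (Finset.mem_insert_of_mem hj) (by simpa using h1)
    have hline : ∀ d ∈ D, ∏ j ∈ S with δ j = d, (l s - l j) ∣
        pencilValue D (b s) (a s) - G.eval (l s) := by
      intro d hd
      -- All graphs crossing that of `s` over the same `d` share one slope, so a single polynomial
      -- linear in the outer variable matches `G` on all of them. Setting that variable to `l s`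
      -- gives the divisibility.
      have h1 : ∏ j ∈ S with δ j = d, (X - C (l j)) ∣
          C (pencilValue D (b s) (a s)) + (X - C (l s)) * C (pencilSlope D d) - G := by
        refine prod_X_sub_C_dvd_of_eval_eq_zero _ l (hl.mono (Finset.coe_subset.2 (Finset.filter_subset _ _))) _ fun j hj => ?_
        obtain ⟨hjS, rfl⟩ := Finset.mem_filter.1 hj
        have h2 := pencilValue_sub (hδ j hjS).1 (hδ j hjS).2
        have h3 := hGS j hjS
        simp only [eval_sub, eval_add, eval_C, eval_mul, eval_X, l, h3] at h2 ⊢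
        linear_combination h2
      have h2 := map_dvd (evalRingHom (l s)) h1
      simpa [eval_prod] using h2
    have hprod : ∏ j ∈ S, (l s - l j) ∣ pencilValue D (b s) (a s) - G.eval (l s) := by
      rw [← Finset.prod_fiberwise_of_maps_to (t := D) (g := δ) fun j hj => (hδ j hj).1]
      refine Finset.prod_dvd_of_coprime ?_ hline
      intro d _ d' _ hdd
      refine IsCoprime.prod_left fun i hi => IsCoprime.prod_right fun j hj => ?_
      obtain ⟨hiS, rfl⟩ := Finset.mem_filter.1 hi
      obtain ⟨hjS, rfl⟩ := Finset.mem_filter.1 hj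
      simp only [l]
      rw [linear_sub_linear (hδ i hiS).2, linear_sub_linear (hδ j hjS).2,
        isCoprime_mul_unit_left_left (isUnit_C.2 (hbs i hiS).isUnit),
        isCoprime_mul_unit_left_right (isUnit_C.2 (hbs j hjS).isUnit)]
      exact isCoprime_X_sub_C_of_isUnit_sub (sub_ne_zero.2 hdd).isUnit
    obtain ⟨h, hh⟩ := hprod
    have hdeg : (∏ j ∈ S, (l s - l j)).degree = S.card := by
      rw [degree_prod, Finset.sum_congr rfl fun j hj => ?_, Finset.sum_const, nsmul_one]
      simp only [l]
      rw [linear_sub_linear (hδ j hj).2, degree_mul, degree_C (hbs j hj), degree_X_sub_C, zero_add]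
    have hmem : (∏ j ∈ S, (l s - l j)) * h ∈ degreeLT K D.card := by
      rw [← hh]
      exact sub_mem (pencilValue_mem_degreeLT D hD _ _) (hG.eval_mem _ _)
    obtain ⟨hh1, hh2⟩ := exists_mem_degreeLT_of_mul_mem hdeg hmem
    refine ⟨G + C h * ∏ j ∈ S, (X - C (l j)), hG.add ?_, fun i hi => ?_⟩
    · rcases hh2 with hh2 | rfl
      · have := BivariateDegreeLT.C_mul_prod S a b hh1
        rwa [Nat.sub_add_cancel hh2] at this
      · intro i
        simp
    · rcases Finset.mem_insert.1 hi with rfl | hi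
      · simp only [eval_add, eval_mul, eval_C, eval_prod, eval_sub, eval_X]
        simp only [l] at hh
        simp only [l]
        linear_combination -hh
      · rw [eval_add, hGS i hi, eval_mul, eval_prod,
          Finset.prod_eq_zero hi (by simp [l]), mul_zero, add_zero]

/-- In characteristic zero, if finitely many affine points determine directions in `D` only, then
each of the points is alone on its line in some direction of `D`. -/
theorem exists_isolated_direction [CharZero K] (D : Finset K) (hD : 2 ≤ D.card) (S : Finset ι)
    (a b : ι → K) (hb : Set.InjOn b S)
    (hS : ∀ i ∈ S, ∀ j ∈ S, i ≠ j → ∃ d ∈ D, b i * d + a i = b j * d + a j)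
    (i : ι) (hi : i ∈ S) :
    ∃ d ∈ D, ∀ j ∈ S, j ≠ i → b j * d + a j ≠ b i * d + a i := by
  classical
  by_contra! hcon
  have hne : D.Nonempty := Finset.card_pos.1 (by omega)
  have hm : (D.card : K) ≠ 0 := by exact_mod_cast hne.card_pos.ne'
  obtain ⟨G, hG, hGS⟩ := exists_interpolation D hne S a b hb hS
  set Q : K[X] := ∏ d ∈ D, (X - C d) with hQ
  set u : K[X] := (derivative G).eval (C (b i) * X + C (a i)) with hu
  have hu_deg : u ∈ degreeLT K (D.card - 1) := hG.derivative.eval_mem _ _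
  have hu_eval : ∀ d ∈ D, u.eval d = (1 - (D.card : K)⁻¹) * (derivative Q).eval d := by
    intro d hd
    obtain ⟨j, hj, hji, hd'⟩ := hcon d hd
    have hbij : b j - b i ≠ 0 := fun h => hji (hb hj hi (sub_eq_zero.1 h))
    -- Taylor expansion of `G` at `l i`: after cancelling `l j - l i`, the remainder still vanishes
    -- at `d`, so `u` and the slope agree there.
    obtain ⟨k, hk⟩ := G.binomExpansion (C (b i) * X + C (a i))
      ((C (b j) * X + C (a j)) - (C (b i) * X + C (a i)))
    rw [add_sub_cancel, hGS i hi, hGS j hj, ← hu] at hk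
    have h1 := pencilValue_sub hd hd'
    have h2 := linear_sub_linear hd'
    have h3 : (C (b j - b i) * (X - C d)) *
        (pencilSlope D d - u - k * (C (b j - b i) * (X - C d))) = 0 := by
      rw [h2] at h1 hk
      linear_combination hk - h1
    have h4 : C (b j - b i) * (X - C d) ≠ 0 :=
      mul_ne_zero (C_ne_zero.2 hbij) (X_sub_C_ne_zero d)
    have h5 := congrArg (eval d) ((mul_eq_zero.1 h3).resolve_left h4)
    have h6 : (derivative Q).eval d = (∏ e ∈ D.erase d, (X - C e)).eval d := by
      rw [hQ, ← Finset.mul_prod_erase D (fun d => X - C d) hd, derivative_mul]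
      simp
    simp only [pencilSlope, eval_sub, eval_mul, eval_C, eval_X, sub_self, mul_zero, eval_zero,
      sub_zero, ← h6, ← hQ] at h5
    linear_combination -h5
  have h7 : u - C (1 - (D.card : K)⁻¹) * derivative Q = 0 := by
    refine eq_zero_of_degree_lt_of_eval_finset_eq_zero D ?_ fun d hd => ?_
    · rw [← mem_degreeLT, ← smul_eq_C_mul]
      exact sub_mem (degreeLT_mono (Nat.sub_le _ _) hu_deg)
        (Submodule.smul_mem _ _ (derivative_prod_mem_degreeLT D))
    · simp [hu_eval d hd]
  have h8 := congrArg (fun q => coeff q (D.card - 1)) h7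
  have h9 : u.coeff (D.card - 1) = 0 := by
    rw [mem_degreeLT, degree_lt_iff_coeff_zero] at hu_deg
    exact hu_deg _ le_rfl
  simp only [coeff_sub, coeff_C_mul, h9, hQ, coeff_derivative_prod D hne, coeff_zero] at h8
  have h10 : (D.card : K) = 1 := by
    field_simp at h8
    linear_combination -h8
  have : D.card = 1 := by exact_mod_cast h10
  omega

/-- The number of pairs of a point and a direction such that the point is alone on its line. -/
theorem max_card_le_card_isolated {κ : Type*} [CharZero K] [DecidableEq K] (T : Finset κ)
    (δ : κ → K) (hδ : Set.InjOn δ T) (hT : 2 ≤ T.card) (S : Finset ι) (hS : S.Nonempty)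
    (a b : ι → K) (hb : Set.InjOn b S)
    (hST : ∀ i ∈ S, ∀ j ∈ S, i ≠ j → ∃ c ∈ T, b i * δ c + a i = b j * δ c + a j)
    (P : Finset (ι × κ))
    (hP : ∀ i ∈ S, ∀ c ∈ T, (∀ j ∈ S, j ≠ i → b j * δ c + a j ≠ b i * δ c + a i) → (i, c) ∈ P) :
    max S.card T.card ≤ P.card := by
  classical
  let F : ι → Finset κ := fun i =>
    T.filter fun c => ∀ j ∈ S, j ≠ i → b j * δ c + a j ≠ b i * δ c + a i
  have hsum : ∑ i ∈ S, (F i).card ≤ P.card := by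
    rw [← Finset.card_sigma]
    refine Finset.card_le_card_of_injOn (fun x => (x.1, x.2)) ?_ ?_
    · rintro ⟨i, c⟩ h
      obtain ⟨hi, hc⟩ := Finset.mem_sigma.1 h
      obtain ⟨hc, h⟩ := Finset.mem_filter.1 hc
      exact hP i hi c hc h
    · rintro ⟨i, c⟩ _ ⟨i', c'⟩ _ h
      simp only [Prod.mk.injEq] at h
      obtain ⟨rfl, rfl⟩ := h
      rfl
  have hone : ∀ i ∈ S, 1 ≤ (F i).card := by
    intro i hi
    obtain ⟨d, hd, h⟩ := exists_isolated_direction (T.image δ)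
      (by rwa [Finset.card_image_of_injOn hδ]) S a b hb
      (fun i hi j hj hij => by
        obtain ⟨c, hc, h⟩ := hST i hi j hj hij
        exact ⟨δ c, Finset.mem_image_of_mem _ hc, h⟩) i hi
    obtain ⟨c, hc, rfl⟩ := Finset.mem_image.1 hd
    exact Finset.card_pos.2 ⟨c, Finset.mem_filter.2 ⟨hc, h⟩⟩
  -- Distinct non-isolated directions of `i` have distinct partners `j`, as two graphs with
  -- different `b` cross only once.
  have htwo : ∀ i ∈ S, T.card + 1 ≤ (F i).card + S.card := by
    intro i hi
    have h1 : (T \ F i).card ≤ (S.erase i).card := by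
      have hex : ∀ c ∈ T \ F i, ∃ j ∈ S.erase i, b j * δ c + a j = b i * δ c + a i := by
        intro c hc
        obtain ⟨hc, hcF⟩ := Finset.mem_sdiff.1 hc
        by_contra! hcon
        exact hcF (Finset.mem_filter.2 ⟨hc, fun j hj hji =>
          hcon j (Finset.mem_erase.2 ⟨hji, hj⟩)⟩)
      have : Nonempty ι := ⟨i⟩
      choose! φ hφ using hex
      refine Finset.card_le_card_of_injOn φ (fun c hc => (hφ c hc).1) ?_
      intro c hc c' hc' h
      have e1 := (hφ c hc).2
      have e2 := (hφ c' hc').2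
      obtain ⟨hne, hmem⟩ := Finset.mem_erase.1 (hφ c hc).1
      rw [← h] at e2
      have hbne : b (φ c) - b i ≠ 0 := fun h => hne (hb hmem hi (sub_eq_zero.1 h))
      refine hδ (Finset.mem_sdiff.1 hc).1 (Finset.mem_sdiff.1 hc').1 ?_
      exact mul_left_cancel₀ hbne (by linear_combination e1 - e2)
    have h2 := Finset.card_sdiff_add_card_eq_card (s := F i) (t := T) (Finset.filter_subset _ _)
    have h3 := Finset.card_erase_add_one hi
    omega
  have hk := hS.card_pos
  have hle1 : S.card ≤ P.card := by
    refine le_trans ?_ hsum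
    simpa using Finset.card_nsmul_le_sum S _ 1 hone
  refine max_le hle1 ?_
  rcases le_or_gt T.card S.card with h | h
  · exact h.trans hle1
  · refine le_trans ?_ hsum
    have h1 : S.card * (T.card + 1 - S.card) ≤ ∑ i ∈ S, (F i).card := by
      refine Finset.card_nsmul_le_sum S _ _ fun i hi => ?_
      have := htwo i hi
      omega
    -- With `k = S.card` and `t = T.card`, `k (t + 1 - k) - t = (k - 1) (t - k) ≥ 0`.
    refine le_trans ?_ h1
    obtain ⟨r, hr⟩ := Nat.exists_eq_add_of_lt h
    obtain ⟨s, hs⟩ := Nat.exists_eq_add_of_lt hk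
    rw [hr, hs, show 0 + s + 1 + r + 1 + 1 - (0 + s + 1) = r + 2 by omega]
    nlinarith [Nat.zero_le (s * r)]

end AffinePoints

/-! ### Linear algebra of planes in three-space. -/

section PlanesInThreeSpace

open Module

variable {K V : Type*} [Field K] [AddCommGroup V] [Module K V]

theorem finrank_inf_eq_one_of_ne [FiniteDimensional K V] (hV : finrank K V = 3)
    {H L : Submodule K V} (hH : finrank K H = 2) (hL : finrank K L = 2) (hne : H ≠ L) :
    finrank K (H ⊓ L : Submodule K V) = 1 := by
  have h1 := Submodule.finrank_sup_add_finrank_inf_eq H L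
  have h2 : H < H ⊔ L := lt_of_le_of_ne le_sup_left fun h => hne <| Eq.symm <|
    Submodule.eq_of_le_of_finrank_eq (sup_eq_left.1 h.symm) (hL.trans hH.symm)
  have h3 := Submodule.finrank_lt_finrank_of_lt h2
  have h4 := Submodule.finrank_le (H ⊔ L)
  omega

theorem exists_dual_of_notMem [FiniteDimensional K V] (hV : finrank K V = 3)
    {H : Submodule K V} (hH : finrank K H = 2) {v : V} (hv : v ∉ H) :
    ∃ f : V →ₗ[K] K, f v = 1 ∧ ∀ w, w ∈ H ↔ f w = 0 := by
  obtain ⟨f, hf, hHf⟩ := Submodule.exists_le_ker_of_notMem hv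
  have hlt : LinearMap.ker f < ⊤ := lt_top_iff_ne_top.2 fun h => hf <| by
    rw [← LinearMap.mem_ker, h]
    trivial
  have h1 := Submodule.finrank_lt hlt.ne
  have h2 := Submodule.finrank_mono hHf
  have h3 := Submodule.eq_of_le_of_finrank_eq hHf (by omega)
  refine ⟨(f v)⁻¹ • f, by simp [hf], fun w => ?_⟩
  rw [h3]
  simp [hf]

theorem exists_notMem_of_finset [Infinite K] [FiniteDimensional K V] (hV : finrank K V = 3)
    (T : Finset (Submodule K V)) (hT : ∀ M ∈ T, finrank K M = 2) : ∃ v, ∀ M ∈ T, v ∉ M := by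
  have := Subspace.biUnion_ne_univ_of_top_notMem (s := T) fun h => by
    have := hT _ h
    rw [finrank_top] at this
    omega
  obtain ⟨v, hv⟩ := (Set.ne_univ_iff_exists_notMem _).1 this
  exact ⟨v, by simpa using hv⟩

theorem exists_generator_of_finrank_eq_one {p : Submodule K V} (hp : finrank K p = 1) :
    ∃ e ≠ 0, p = Submodule.span K {e} := by
  obtain ⟨v, hv, h⟩ := finrank_eq_one_iff'.1 hp
  refine ⟨v, by simpa using hv, le_antisymm (fun w hw => ?_) (by simp)⟩
  obtain ⟨c, hc⟩ := h ⟨w, hw⟩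
  exact Submodule.mem_span_singleton.2 ⟨c, congrArg Subtype.val hc⟩

end PlanesInThreeSpace

/-! ### Intersection points and affine coordinates. -/

namespace LineArrangement

open Module

variable {K : Type*} [Field K] (A : LineArrangement K)

theorem mem_linesThrough {p H : Submodule K (Fin 3 → K)} :
    H ∈ A.linesThrough p ↔ H ∈ A.lines ∧ p ≤ H := by
  classical
  simp [linesThrough]

theorem finite_points : A.points.Finite := by
  refine Set.Finite.subset ((A.lines.finite_toSet.finite_subsets).image sInf) ?_
  rintro X ⟨⟨B, hB, rfl⟩, -⟩
  exact ⟨B, hB, rfl⟩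

theorem two_le_card_linesThrough {p : Submodule K (Fin 3 → K)} (hp : p ∈ A.points) :
    2 ≤ (A.linesThrough p).card := by
  obtain ⟨⟨B, hB, hpB⟩, h1⟩ := hp
  have hsub : ∀ H ∈ B, H ∈ A.linesThrough p := fun H hH =>
    A.mem_linesThrough.2 ⟨hB hH, hpB ▸ sInf_le hH⟩
  by_contra hcon
  rcases B.eq_empty_or_nonempty with rfl | ⟨H, hH⟩
  · rw [sInf_empty] at hpB
    rw [hpB, finrank_top] at h1
    simp at h1
  · have : B = {H} := by
      ext L
      refine ⟨fun hL => ?_, fun hL => hL ▸ hH⟩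
      exact Finset.card_le_one.1 (by omega) _ (hsub _ hL) _ (hsub _ hH)
    rw [this, sInf_singleton] at hpB
    have := A.finrank_eq_two H (hB hH)
    rw [← hpB] at this
    omega

theorem inf_mem_points {H M : Submodule K (Fin 3 → K)} (hH : H ∈ A.lines) (hM : M ∈ A.lines)
    (hne : H ≠ M) : H ⊓ M ∈ A.points :=
  ⟨⟨{H, M}, by simp [Set.insert_subset_iff, hH, hM], by simp⟩,
    finrank_inf_eq_one_of_ne (by simp) (A.finrank_eq_two H hH) (A.finrank_eq_two M hM) hne⟩

/-- Affine coordinates adapted to a point `p` that is on some, but not all lines: the lines through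
`p` become the vertical lines `x = δ M` and the others the graphs of the functions
`x ↦ -(b H * x + a H)`. -/
theorem exists_coordinates [CharZero K] {p : Submodule K (Fin 3 → K)} (hp : finrank K p = 1)
    (hon : (A.linesThrough p).Nonempty) (hoff : ∃ H ∈ A.lines, ¬ p ≤ H) :
    ∃ (u v e : Fin 3 → K) (a b δ : Submodule K (Fin 3 → K) → K),
      (∀ w, ∃ x y z : K, w = x • u + y • v + z • e) ∧
      (∀ M ∈ A.linesThrough p, ∀ x y z : K, x • u + y • v + z • e ∈ M ↔ x = δ M * y) ∧
      (∀ H ∈ A.lines, ¬ p ≤ H → ∀ x y z : K,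
        x • u + y • v + z • e ∈ H ↔ b H * x + a H * y + z = 0) := by
  have h3 : finrank K (Fin 3 → K) = 3 := by simp
  obtain ⟨e, -, he⟩ := exists_generator_of_finrank_eq_one hp
  have hpe : ∀ H, p ≤ H ↔ e ∈ H := fun H => by
    rw [he, Submodule.span_singleton_le_iff_mem]
  have hthr : ∀ M ∈ A.linesThrough p, finrank K M = 2 := fun M hM =>
    A.finrank_eq_two M (A.mem_linesThrough.1 hM).1
  obtain ⟨u, hu⟩ := exists_notMem_of_finset h3 (A.linesThrough p) hthr
  have hg : ∀ M ∈ A.linesThrough p, ∃ g : (Fin 3 → K) →ₗ[K] K, g u = 1 ∧ ∀ w, w ∈ M ↔ g w = 0 :=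
    fun M hM => exists_dual_of_notMem h3 (hthr M hM) (hu M hM)
  choose! g hgu hg using hg
  have hf : ∀ H ∈ A.lines, ¬ p ≤ H →
      ∃ f : (Fin 3 → K) →ₗ[K] K, f e = 1 ∧ ∀ w, w ∈ H ↔ f w = 0 :=
    fun H hH hpH => exists_dual_of_notMem h3 (A.finrank_eq_two H hH) (by rwa [← hpe])
  choose! f hfe hf using hf
  obtain ⟨M₀, hM₀⟩ := hon
  obtain ⟨H₀, hH₀, hpH₀⟩ := hoff
  have hge : ∀ M ∈ A.linesThrough p, g M e = 0 := fun M hM =>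
    (hg M hM e).1 ((hpe M).1 (A.mem_linesThrough.1 hM).2)
  have hne : H₀ ≠ M₀ := fun h => hpH₀ (h ▸ (A.mem_linesThrough.1 hM₀).2)
  obtain ⟨v, -, hv⟩ := exists_generator_of_finrank_eq_one
    (finrank_inf_eq_one_of_ne h3 (A.finrank_eq_two H₀ hH₀) (hthr M₀ hM₀) hne)
  refine ⟨u, v, e, fun H => f H v, fun H => f H u, fun M => - g M v, ?_, ?_, ?_⟩
  · intro w
    set w₁ := w - g M₀ w • u with hw₁
    have h1 : g M₀ w₁ = 0 := by simp [hw₁, hgu M₀ hM₀]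
    have h2 : w₁ - f H₀ w₁ • e ∈ H₀ ⊓ M₀ := by
      refine ⟨(hf H₀ hH₀ hpH₀ _).2 ?_, (hg M₀ hM₀ _).2 ?_⟩
      · simp [hfe H₀ hH₀ hpH₀]
      · simp [h1, hge M₀ hM₀]
    rw [hv] at h2
    obtain ⟨y, hy⟩ := Submodule.mem_span_singleton.1 h2
    exact ⟨g M₀ w, y, f H₀ w₁, by rw [hy, hw₁]; abel⟩
  · intro M hM x y z
    rw [hg M hM]
    simp only [map_add, map_smul, smul_eq_mul, hgu M hM, hge M hM]
    constructor <;> intro h <;> linear_combination h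
  · intro H hH hpH x y z
    rw [hf H hH hpH]
    simp only [map_add, map_smul, smul_eq_mul, hfe H hH hpH]
    constructor <;> intro h <;> linear_combination h

end LineArrangement

/-! ### Counting double points. -/

open LineArrangement in
theorem theorem3p7 {K : Type*} [Field K] [CharZero K] (A : LineArrangement K)
    (p : Submodule K (Fin 3 → K)) (hp : A.IsModularPoint p)
    (m : ℕ) (hm : A.mu p = (m : ℤ) - 1)
    (hoff : ∃ H ∈ A.lines, ¬ p ≤ H) :
    max ((A.lines.card : ℤ) - (m : ℤ)) (m : ℤ) ≤ (A.n2 : ℤ) := by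
  classical
  obtain ⟨hpA, hmod⟩ := hp
  have hT2 := A.two_le_card_linesThrough hpA
  obtain ⟨u, v, e, a, b, δ, hspan, hon, hoff'⟩ :=
    A.exists_coordinates hpA.2 (Finset.card_pos.1 (by omega)) hoff
  set T := A.linesThrough p with hT
  set S := A.lines.filter fun H => ¬ p ≤ H with hS
  have hSmem : ∀ {H}, H ∈ S ↔ H ∈ A.lines ∧ ¬ p ≤ H := Finset.mem_filter
  have hcard : A.lines.card = T.card + S.card := by
    rw [hT, hS, linesThrough]
    convert (Finset.card_filter_add_card_filter_not (s := A.lines) fun H => p ≤ H).symm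
  have hmT : m = T.card := by
    rw [mu, ← hT] at hm
    omega
  have hδ : Set.InjOn δ T := fun M hM N hN h => by
    ext w
    obtain ⟨x, y, z, rfl⟩ := hspan w
    rw [hon M hM, hon N hN, h]
  have hmeet : ∀ H ∈ S, ∀ L ∈ S, H ≠ L → ∃ M ∈ T, b H * δ M + a H = b L * δ M + a L := by
    intro H hH L hL hne
    obtain ⟨hHA, hpH⟩ := hSmem.1 hH
    obtain ⟨hLA, hpL⟩ := hSmem.1 hL
    obtain ⟨M, ⟨hM, hle⟩, -⟩ := hmod H hHA L hLA hpH hpL hne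
    refine ⟨M, hM, ?_⟩
    obtain ⟨w, hw0, hw⟩ := exists_generator_of_finrank_eq_one (A.inf_mem_points hHA hLA hne).2
    have hwHL : w ∈ H ⊓ L := hw ▸ Submodule.mem_span_singleton_self w
    have hwM := hle hwHL
    obtain ⟨x, y, z, rfl⟩ := hspan w
    have h1 := (hoff' H hHA hpH x y z).1 hwHL.1
    have h2 := (hoff' L hLA hpL x y z).1 hwHL.2
    obtain rfl := (hon M hM x y z).1 hwM
    have hy : y ≠ 0 := by
      rintro rfl
      have : z = 0 := by simpa using h1
      exact hw0 (by simp [this])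
    exact mul_right_cancel₀ hy (by linear_combination h1 - h2)
  have hb : Set.InjOn b S := by
    intro H hH L hL h
    by_contra hne
    obtain ⟨M, -, hM⟩ := hmeet H hH L hL hne
    have ha : a H = a L := by
      rw [h] at hM
      exact add_left_cancel hM
    apply hne
    ext w
    obtain ⟨x, y, z, rfl⟩ := hspan w
    rw [hoff' H (hSmem.1 hH).1 (hSmem.1 hH).2, hoff' L (hSmem.1 hL).1 (hSmem.1 hL).2, h, ha]
  have hdouble : ∀ H ∈ S, ∀ M ∈ T,
      (∀ L ∈ S, L ≠ H → b L * δ M + a L ≠ b H * δ M + a H) →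
      H ⊓ M ∈ A.points ∧ A.linesThrough (H ⊓ M) = {H, M} ∧ H ≠ M := by
    intro H hH M hM hiso
    obtain ⟨hHA, hpH⟩ := hSmem.1 hH
    obtain ⟨hMA, hpM⟩ := A.mem_linesThrough.1 hM
    have hne : H ≠ M := fun h => hpH (h ▸ hpM)
    refine ⟨A.inf_mem_points hHA hMA hne, ?_, hne⟩
    ext N
    rw [A.mem_linesThrough, Finset.mem_insert, Finset.mem_singleton]
    constructor
    · rintro ⟨hNA, hN⟩
      -- This vector spans `H ⊓ M`: the point over `x = δ M`, normalised by `y = 1`.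
      have hw : δ M • u + (1 : K) • v + (-(b H * δ M + a H)) • e ∈ N :=
        hN ⟨(hoff' H hHA hpH _ _ _).2 (by ring), (hon M hM _ _ _).2 (by ring)⟩
      by_cases hpN : p ≤ N
      · have hNT := A.mem_linesThrough.2 ⟨hNA, hpN⟩
        right
        exact hδ hNT hM (by simpa using ((hon N hNT _ _ _).1 hw).symm)
      · left
        by_contra hNH
        have := (hoff' N hNA hpN _ _ _).1 hw
        exact hiso N (hSmem.2 ⟨hNA, hpN⟩) hNH (by linear_combination this)
    · rintro (rfl | rfl)
      · exact ⟨hHA, inf_le_left⟩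
      · exact ⟨hMA, inf_le_right⟩
  let P := (S ×ˢ T).filter fun x =>
    ∀ L ∈ S, L ≠ x.1 → b L * δ x.2 + a L ≠ b x.1 * δ x.2 + a x.1
  have hPmem : ∀ {x}, x ∈ P ↔ (x.1 ∈ S ∧ x.2 ∈ T) ∧
      ∀ L ∈ S, L ≠ x.1 → b L * δ x.2 + a L ≠ b x.1 * δ x.2 + a x.1 := by simp [P]
  have hmax := max_card_le_card_isolated T δ hδ hT2 S
    (by obtain ⟨H, hH⟩ := hoff; exact ⟨H, hSmem.2 hH⟩) a b hb hmeet P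
    fun H hH M hM h => hPmem.2 ⟨⟨hH, hM⟩, h⟩
  have hPn : P.card ≤ A.n2 := by
    rw [← Set.ncard_coe_finset, n2]
    refine Set.ncard_le_ncard_of_injOn (fun x => x.1 ⊓ x.2) ?_ ?_
      (A.finite_points.subset fun q hq => hq.1)
    · intro x hx
      obtain ⟨⟨hH, hM⟩, hiso⟩ := hPmem.1 hx
      obtain ⟨h1, h2, hne⟩ := hdouble _ hH _ hM hiso
      refine ⟨h1, ?_⟩
      rw [mu, h2, Finset.card_pair hne]
      norm_num
    · rintro ⟨H, M⟩ hx ⟨H', M'⟩ hx' h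
      obtain ⟨⟨hH, hM⟩, hiso⟩ := hPmem.1 hx
      obtain ⟨⟨hH', hM'⟩, hiso'⟩ := hPmem.1 hx'
      obtain ⟨-, h2, -⟩ := hdouble _ hH _ hM hiso
      obtain ⟨-, h2', -⟩ := hdouble _ hH' _ hM' hiso'
      simp only at h h2 h2' hH hM hH' hM'
      rw [h, h2'] at h2
      -- A double point determines its two lines, and passing through `p` tells which is which.
      have off_ne_on : ∀ {L N}, L ∈ S → N ∈ T → L ≠ N := fun hL hN h =>
        (hSmem.1 hL).2 (h ▸ (A.mem_linesThrough.1 hN).2)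
      have e1 : H' ∈ ({H, M} : Finset _) := h2 ▸ Finset.mem_insert_self _ _
      have e2 : M' ∈ ({H, M} : Finset _) := h2 ▸ by simp
      simp only [Finset.mem_insert, Finset.mem_singleton] at e1 e2
      rw [e1.resolve_right (off_ne_on hH' hM), e2.resolve_left (off_ne_on hH hM').symm]
  subst hmT
  have h1 := le_trans (le_max_left _ _) hmax
  have h2 := le_trans (le_max_right _ _) hmax
  rw [hcard]
  push_cast
  apply max_le <;> omega
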